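/- For a real number $\xi$, let $\mu(\xi)\in[1,\infty]$ be the supremum of all real $m$ for which $|\xi-p/q|\le q^{-m}$ has infinitely many solutions in rational numbers $p/q$ (with $q\ge 1$). For an integer $b\ge 2$, let $\theta_b(\xi)\in[1,\infty]$ be defined in the same way, except that only rational numbers written as $p/q$ with $q=b^N$, $N\ge 0$ an integer, are admitted. In both cases distinct solutions means distinct rational numbers. Put \[ \mathscr{W}_{\lambda}=\{\xi\in\mathbb{R}:\mu(\xi)=\lambda\},\qquad \mathscr{V}_{\lambda,(b)}=\{\xi\in\mathbb{R}:\theta_b(\xi)=\lambda\}. \] Then for every integer $b\ge 2$ and every $\lambda$ with $\frac{5+\sqrt{17}}{2}<\lambda\le\infty$, the set $\mathscr{W}_{\lambda}\cap\mathscr{V}_{\lambda,(b)}$ has packing dimension $1$. Here the packing dimension of $F\subseteq\mathbb{R}$ is $\dim_P F=\sup\{s\ge 0: P^s(F)=\infty\}$ (with $\sup\emptyset=0$), where $P^s$ is the $s$-dimensional packing measure: $P^s(F)=\inf\{\sum_{i} P^s_0(F_i): F\subseteq\bigcup_{i\in\mathbb{N}}F_i\}$, and $P^s_0(F)=\lim_{\delta\to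 0^+}\sup\sum_i|B_i|^s$, the supremum being over all countable families of pairwise disjoint closed balls $B_i$ of radii in $(0,\delta]$ with centres in $F$, and $|B_i|$ denoting the diameter of $B_i$. -/

import Mathlib

open scoped ENNReal NNReal

noncomputable section

namespace DiophPacking

/-! ### Exponents of rational approximation -/

/-- The supremum (in the extended reals) of all real `m` for which `|ξ - p/q| ≤ q ^ (-m)` is
solved by infinitely many rational numbers `r = p/q` whose denominator `q` is taken from `D`.
Solutions are counted as rational numbers, not as pairs `(p, q)`. -/
def approxExponent (D : Set ℕ) (ξ : ℝ) : EReal :=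
  ⨆ (m : ℝ) (_ : {r : ℚ | ∃ (p : ℤ) (q : ℕ), q ∈ D ∧ r = (p : ℚ) / (q : ℚ) ∧
      |ξ - (r : ℝ)| ≤ (q : ℝ) ^ (-m)}.Infinite), (m : EReal)

/-- The irrationality exponent of `ξ`: all positive denominators are allowed. -/
def irrExponent (ξ : ℝ) : EReal := approxExponent {q | 0 < q} ξ

/-- The `b`-ary exponent of `ξ`: only denominators `b ^ N` are allowed. -/
def baryExponent (b : ℕ) (ξ : ℝ) : EReal := approxExponent {q | ∃ N : ℕ, q = b ^ N} ξ

/-- The real numbers whose irrationality exponent is exactly `lam`. -/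
def levelW (lam : EReal) : Set ℝ := {ξ | irrExponent ξ = lam}

/-- The real numbers whose `b`-ary exponent is exactly `lam`. -/
def levelV (b : ℕ) (lam : EReal) : Set ℝ := {ξ | baryExponent b ξ = lam}

/-! ### Packing measure and packing dimension of sets of real numbers -/

/-- `I`, a set of pairs (centre, radius), is a `δ`-packing of `F`: a countable family of pairwise
disjoint closed balls with centres in `F` and radii in `(0, δ]`. -/
structure IsPacking (δ : ℝ) (F : Set ℝ) (I : Set (ℝ × ℝ)) : Prop where
  countable : I.Countable
  center_mem : ∀ B ∈ I, B.1 ∈ F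
  radius_pos : ∀ B ∈ I, 0 < B.2
  radius_le : ∀ B ∈ I, B.2 ≤ δ
  disjoint : I.PairwiseDisjoint fun B => Metric.closedBall B.1 B.2

/-- The supremum of `∑ |B| ^ s` over all `δ`-packings of `F`, where `|B|` is the diameter `2 r`
of the ball `B`. -/
def packingSup (s : ℝ≥0) (δ : ℝ) (F : Set ℝ) : ℝ≥0∞ :=
  ⨆ (I : Set (ℝ × ℝ)) (_ : IsPacking δ F I), ∑' B : I, ENNReal.ofReal (2 * B.1.2) ^ (s : ℝ)

/-- The `s`-dimensional packing premeasure: the (decreasing) limit of `packingSup s δ F` as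
`δ → 0+`. -/
def packingPremeasure (s : ℝ≥0) (F : Set ℝ) : ℝ≥0∞ :=
  ⨅ (δ : ℝ) (_ : 0 < δ), packingSup s δ F

/-- The `s`-dimensional packing (outer) measure. -/
def packingMeasure (s : ℝ≥0) (F : Set ℝ) : ℝ≥0∞ :=
  ⨅ (t : ℕ → Set ℝ) (_ : F ⊆ ⋃ i, t i), ∑' i, packingPremeasure s (t i)

/-- The packing dimension: the supremum of all `s ≥ 0` with infinite `s`-dimensional packing
measure (and `0` if there is no such `s`). -/
def dimP (F : Set ℝ) : ℝ≥0∞ :=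
  ⨆ (s : ℝ≥0) (_ : packingMeasure s F = ⊤), (s : ℝ≥0∞)

end DiophPacking

end

namespace DiophPacking

open MeasureTheory Filter Topology Set

/-! ### Packings of sets of real numbers -/

/-! The upper bound is a volume count. For the lower bound let `s < 1`. Packing measure is an
infimum over countable covers, so it suffices to find, for any countable family of sets `t k` of
finite premeasure, a point of the intersection outside all of them. As in Baire's theorem, such a
point is the limit of nested intervals, one set being escaped at each stage.

The intervals are windows of size `Q ^ (-l)` just to the right of fractions `P / Q`, with `Q = b ^
n` and `P ≡ 1` mod `b`. Inside a window of length `L`, at least about `L * Q / b` admissible windows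
of a finer level `Q` are available, at mutual distance more than `1 / (2 * Q)`. If all of them met
`t`, balls of radius `1 / (4 * Q)` centred at the meeting points would have packing sum of order `Q
^ (1 - s)`, unbounded in `Q`, although `t` has finite `packingSup` at some scale
(`exists_window_subset_disjoint`).

The windows force the `b`-ary exponent to be at least `l`. For the irrationality exponent,
admissible windows lie near points far from rationals of moderate denominator. Then every `p / q`
with `q` large, other than the chosen `P / Q`, stays at distance at least `q ^ (-4)` from the limit
(`inv_pow_four_le_abs_sub`). Hence only `λ > 4` is needed, which the bound with `√17` implies. -/

theorem packingSup_le_of_subset_Icc {s : ℝ≥0} (hs : 1 ≤ s) {a δ : ℝ} (hδ : δ ≤ 1) {t : Set ℝ}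
    (ht : t ⊆ Icc a (a + 1)) :
    packingSup s δ t ≤ ENNReal.ofReal (2 * δ) ^ ((s : ℝ) - 1) * 3 := by
  have hs' : 0 ≤ (s : ℝ) - 1 := by
    have : (1 : ℝ) ≤ s := by exact_mod_cast hs
    linarith
  refine iSup₂_le fun I hI => ?_
  have key : ∀ B : I, ENNReal.ofReal (2 * B.1.2) ^ (s : ℝ) ≤
      ENNReal.ofReal (2 * δ) ^ ((s : ℝ) - 1) * volume (Metric.closedBall B.1.1 B.1.2) := by
    intro B
    have h0 := hI.radius_pos _ B.2
    have h1 := hI.radius_le _ B.2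
    have e : (s : ℝ) = ((s : ℝ) - 1) + 1 := by ring
    rw [Real.volume_closedBall]
    conv_lhs => rw [e]
    rw [ENNReal.rpow_add _ _ (by simpa using h0) ENNReal.ofReal_ne_top, ENNReal.rpow_one]
    gcongr
  calc ∑' B : I, ENNReal.ofReal (2 * B.1.2) ^ (s : ℝ)
      ≤ ∑' B : I, ENNReal.ofReal (2 * δ) ^ ((s : ℝ) - 1) *
          volume (Metric.closedBall B.1.1 B.1.2) := ENNReal.tsum_le_tsum key
    _ = ENNReal.ofReal (2 * δ) ^ ((s : ℝ) - 1) *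
          volume (⋃ B ∈ I, Metric.closedBall B.1 B.2) := by
        rw [ENNReal.tsum_mul_left, measure_biUnion hI.countable hI.disjoint
          fun B _ => Metric.isClosed_closedBall.measurableSet]
    _ ≤ ENNReal.ofReal (2 * δ) ^ ((s : ℝ) - 1) * volume (Icc (a - 1) (a + 2)) := by
        gcongr
        refine iUnion₂_subset fun B hB x hx => ?_
        have h1 := hI.radius_le _ hB
        have h2 := ht (hI.center_mem _ hB)
        rw [Real.closedBall_eq_Icc] at hx
        exact ⟨by linarith [hx.1, h2.1], by linarith [hx.2, h2.2]⟩
    _ = ENNReal.ofReal (2 * δ) ^ ((s : ℝ) - 1) * 3 := by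
        rw [Real.volume_Icc]
        norm_num

theorem packingPremeasure_eq_zero_of_subset_Icc {s : ℝ≥0} (hs : 1 < s) {a : ℝ} {t : Set ℝ}
    (ht : t ⊆ Icc a (a + 1)) : packingPremeasure s t = 0 := by
  have hs' : 0 < (s : ℝ) - 1 := sub_pos.2 (by exact_mod_cast hs)
  have lim : Tendsto (fun δ : ℝ => ENNReal.ofReal (2 * δ) ^ ((s : ℝ) - 1) * 3)
      (𝓝[>] 0) (𝓝 0) := by
    have h1 : Tendsto (fun δ : ℝ => ENNReal.ofReal (2 * δ)) (𝓝[>] 0) (𝓝 0) := by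
      have : Continuous fun δ : ℝ => ENNReal.ofReal (2 * δ) :=
        ENNReal.continuous_ofReal.comp (continuous_const.mul continuous_id)
      simpa using (this.tendsto 0).mono_left nhdsWithin_le_nhds
    have h2 := (ENNReal.continuous_rpow_const (y := (s : ℝ) - 1)).tendsto 0
    rw [ENNReal.zero_rpow_of_pos hs'] at h2
    simpa using ENNReal.Tendsto.mul_const (b := 3) (h2.comp h1) (Or.inr (by norm_num))
  refine le_antisymm (ge_of_tendsto lim ?_) zero_le
  filter_upwards [Ioc_mem_nhdsGT (zero_lt_one' ℝ)] with δ hδ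
  exact (iInf₂_le δ hδ.1).trans (packingSup_le_of_subset_Icc hs.le hδ.2 ht)

theorem dimP_le_one (F : Set ℝ) : dimP F ≤ 1 := by
  refine iSup₂_le fun s hs => ?_
  by_contra! h
  have h1 : 1 < s := by exact_mod_cast h
  obtain ⟨e, he⟩ := exists_surjective_nat ℤ
  have : packingMeasure s F ≤ ∑' i, packingPremeasure s (Icc (e i : ℝ) (e i + 1)) := by
    refine iInf₂_le (fun i => Icc (e i : ℝ) (e i + 1)) fun x _ => ?_
    obtain ⟨i, hi⟩ := he ⌊x⌋
    exact mem_iUnion.2 ⟨i, by rw [hi]; exact ⟨Int.floor_le x, (Int.lt_floor_add_one x).le⟩⟩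
  simp [packingPremeasure_eq_zero_of_subset_Icc h1 Subset.rfl, hs] at this

theorem tsum_le_packingSup_of_separated {ι : Type*} [Countable ι] {s : ℝ≥0} {δ ρ : ℝ} {t : Set ℝ}
    {S : Set ι} (y : ι → ℝ) (hρ : 0 < ρ) (hρδ : ρ ≤ δ) (hy : ∀ i ∈ S, y i ∈ t)
    (hsep : S.Pairwise fun i j => 2 * ρ < |y i - y j|) :
    ∑' _ : S, ENNReal.ofReal (2 * ρ) ^ (s : ℝ) ≤ packingSup s δ t := by
  have inj : S.InjOn fun i => (y i, ρ) := by
    intro i hi j hj hij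
    by_contra hne
    have : 2 * ρ < |y i - y j| := hsep hi hj hne
    simp only [Prod.mk.injEq, and_true] at hij
    rw [hij, sub_self, abs_zero] at this
    linarith
  refine le_iSup₂_of_le ((fun i => (y i, ρ)) '' S) ⟨S.to_countable.image _, ?_, ?_, ?_, ?_⟩ ?_
  · rintro _ ⟨i, hi, rfl⟩
    exact hy i hi
  · rintro _ ⟨i, hi, rfl⟩
    exact hρ
  · rintro _ ⟨i, hi, rfl⟩
    exact hρδ
  · rintro _ ⟨i, hi, rfl⟩ _ ⟨j, hj, rfl⟩ hij
    have hne : i ≠ j := fun h => hij (by rw [h])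
    refine Metric.closedBall_disjoint_closedBall ?_
    rw [Real.dist_eq]
    linarith [hsep hi hj hne]
  · rw [tsum_image (fun B : ℝ × ℝ => ENNReal.ofReal (2 * B.2) ^ (s : ℝ)) inj]

/-- A set escaping every countable family of sets of finite `s`-dimensional premeasure has infinite
`s`-dimensional packing measure. -/
theorem packingMeasure_eq_top_of_forall {s : ℝ≥0} {F : Set ℝ}
    (h : ∀ t : ℕ → Set ℝ, (∀ k, packingPremeasure s (t k) ≠ ⊤) → ∃ x ∈ F, ∀ k, x ∉ t k) :
    packingMeasure s F = ⊤ := by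
  refine iInf₂_eq_top.2 fun t ht => ?_
  by_contra hne
  obtain ⟨x, hx, hxt⟩ := h t fun k => ENNReal.ne_top_of_tsum_ne_top hne k
  obtain ⟨k, hk⟩ := mem_iUnion.1 (ht hx)
  exact hxt k hk

theorem one_le_dimP {F : Set ℝ} (h : ∀ s : ℝ≥0, s < 1 → packingMeasure s F = ⊤) :
    1 ≤ dimP F := by
  refine le_of_forall_lt fun c hc => ?_
  lift c to ℝ≥0 using hc.ne_top
  have hc' : c < 1 := by exact_mod_cast hc
  obtain ⟨d, hcd, hd⟩ := exists_between hc'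
  refine lt_of_lt_of_le (by exact_mod_cast hcd) (le_iSup₂_of_le d (h d hd) le_rfl)

/-! ### Points far from rationals with large denominators -/

theorem volume_biUnion_ball_le {u L C : ℝ} {q : ℕ} (hL : 0 ≤ L) (hC : 0 ≤ C) (hq : 0 < q) :
    volume (⋃ p ∈ Finset.Icc ⌈q * u - 1⌉ ⌊q * (u + L / 2) + 1⌋,
      Metric.ball ((p : ℝ) / q) (C / q ^ 3)) ≤
    ENNReal.ofReal (C * L * ((q : ℝ) ^ 2)⁻¹ + 6 * C * ((q : ℝ) ^ 3)⁻¹) := by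
  have hq' : (0 : ℝ) < q := by exact_mod_cast hq
  have hcard : ((Finset.Icc ⌈q * u - 1⌉ ⌊q * (u + L / 2) + 1⌋).card : ℝ) ≤ q * L / 2 + 3 := by
    rw [Int.card_Icc]
    have h1 := Int.le_ceil (q * u - 1)
    have h2 := Int.floor_le (q * (u + L / 2) + 1)
    have h3 : (((⌊q * (u + L / 2) + 1⌋ + 1 - ⌈q * u - 1⌉).toNat : ℤ) : ℝ) ≤ q * L / 2 + 3 := by
      rw [Int.toNat_eq_max, Int.cast_max]
      refine max_le ?_ (by push_cast; positivity)
      push_cast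
      linarith
    exact_mod_cast h3
  refine (measure_biUnion_finset_le _ _).trans ?_
  simp only [Real.volume_ball, Finset.sum_const, nsmul_eq_mul]
  rw [← ENNReal.ofReal_natCast, ← ENNReal.ofReal_mul (Nat.cast_nonneg _)]
  refine ENNReal.ofReal_le_ofReal ?_
  calc _ ≤ (q * L / 2 + 3) * (2 * (C / q ^ 3)) := by gcongr
    _ = _ := by field_simp; ring

/-- Union bound: by `∑ 1 / q ^ 2 ≤ 2 / M` the excluded part has measure at most `2 * C * L / M + 12
* C / M ^ 2`. The hypotheses `hM` and `hML` make each term at most `L / 8`. Only the left half of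
the interval is used, so that points can later be shifted to the right. -/
theorem ofReal_le_volume_far_from_rationals {u L C : ℝ} {M : ℕ} (N : ℕ) (hL : 0 < L) (hC : 1 ≤ C)
    (hM : 16 * C ≤ M) (hML : 96 * C ≤ L * M ^ 2) :
    ENNReal.ofReal (L / 4) ≤ volume {x ∈ Icc u (u + L / 2) |
      ∀ q : ℕ, M ≤ q → q < N → ∀ p : ℤ, C / q ^ 3 ≤ |x - p / q|} := by
  set G := {x ∈ Icc u (u + L / 2) |
      ∀ q : ℕ, M ≤ q → q < N → ∀ p : ℤ, C / q ^ 3 ≤ |x - p / q|}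
  have hM0 : (0 : ℝ) < M := by linarith
  have hM0' : 0 < M := by exact_mod_cast hM0
  let bad : ℕ → Set ℝ := fun q => ⋃ p ∈ Finset.Icc ⌈q * u - 1⌉ ⌊q * (u + L / 2) + 1⌋,
      Metric.ball ((p : ℝ) / q) (C / q ^ 3)
  have cover : Icc u (u + L / 2) ⊆ G ∪ ⋃ q ∈ Finset.Ico M N, bad q := by
    intro x hx
    by_contra hn
    simp only [mem_union, not_or] at hn
    refine hn.1 ⟨hx, fun q hMq hqN p => ?_⟩
    by_contra! hlt
    refine hn.2 ?_
    have hq : (M : ℝ) ≤ q := by exact_mod_cast hMq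
    have hq0 : (0 : ℝ) < q := by linarith
    have h1 : |q * x - p| ≤ 1 := by
      have e : q * x - p = q * (x - p / q) := by field_simp
      rw [e, abs_mul, abs_of_pos hq0]
      calc q * |x - p / q| ≤ q * (C / q ^ 3) := by gcongr
        _ = C / q ^ 2 := by field_simp
        _ ≤ 1 := by
          rw [div_le_one (by positivity)]
          nlinarith
    rw [abs_le] at h1
    simp only [mem_iUnion, bad]
    refine ⟨q, Finset.mem_Ico.2 ⟨hMq, hqN⟩, p, Finset.mem_Icc.2 ⟨?_, ?_⟩, ?_⟩
    · rw [Int.ceil_le]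
      nlinarith [hx.1]
    · rw [Int.le_floor]
      nlinarith [hx.2]
    · rwa [Metric.mem_ball, Real.dist_eq]
  have hsq : ∑ q ∈ Finset.Ico M N, ((q : ℝ) ^ 2)⁻¹ ≤ 2 / M := by
    have h := sum_Ioo_inv_sq_le (α := ℝ) (M - 1) N
    have e : Finset.Ioo (M - 1) N = Finset.Ico M N := by
      ext q
      simp only [Finset.mem_Ioo, Finset.mem_Ico]
      omega
    have e2 : ((M - 1 : ℕ) : ℝ) + 1 = M := by
      rw [Nat.cast_sub hM0']
      simp
    rwa [e, e2] at h
  have hbad : volume (⋃ q ∈ Finset.Ico M N, bad q) ≤ ENNReal.ofReal (L / 4) := by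
    refine (measure_biUnion_finset_le _ _).trans ?_
    calc ∑ q ∈ Finset.Ico M N, volume (bad q)
        ≤ ∑ q ∈ Finset.Ico M N, ENNReal.ofReal ((C * L + 6 * C / M) * ((q : ℝ) ^ 2)⁻¹) := by
          refine Finset.sum_le_sum fun q hq => ?_
          have hMq : (M : ℝ) ≤ q := by exact_mod_cast (Finset.mem_Ico.1 hq).1
          have hq0 : (0 : ℝ) < q := by linarith
          refine (volume_biUnion_ball_le hL.le (by linarith) (by exact_mod_cast hq0)).trans
            (ENNReal.ofReal_le_ofReal ?_)
          have : ((q : ℝ) ^ 3)⁻¹ ≤ (M : ℝ)⁻¹ * ((q : ℝ) ^ 2)⁻¹ := by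
            rw [← mul_inv]
            refine inv_anti₀ (by positivity) ?_
            rw [pow_succ' _ 2]
            gcongr
          calc _ ≤ C * L * ((q : ℝ) ^ 2)⁻¹ + 6 * C * ((M : ℝ)⁻¹ * ((q : ℝ) ^ 2)⁻¹) := by gcongr
            _ = _ := by ring
      _ = ENNReal.ofReal ((C * L + 6 * C / M) * ∑ q ∈ Finset.Ico M N, ((q : ℝ) ^ 2)⁻¹) := by
          rw [Finset.mul_sum, ENNReal.ofReal_sum_of_nonneg fun q _ => by positivity]
      _ ≤ ENNReal.ofReal (L / 4) := by
          refine ENNReal.ofReal_le_ofReal ?_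
          calc _ ≤ (C * L + 6 * C / M) * (2 / M) := by gcongr
            _ ≤ L / 4 := by
              have e : (C * L + 6 * C / M) * (2 / M) = (2 * C * L * M + 12 * C) / M ^ 2 := by
                field_simp
                ring
              rw [e, div_le_iff₀ (by positivity)]
              nlinarith [mul_le_mul_of_nonneg_left hM (mul_pos hL hM0).le]
  have h := (measure_mono cover).trans (measure_union_le (μ := volume) _ _)
  rw [Real.volume_Icc] at h
  have h2 : ENNReal.ofReal (L / 4) + ENNReal.ofReal (L / 4) ≤
      volume G + ENNReal.ofReal (L / 4) := by
    rw [← ENNReal.ofReal_add (by positivity) (by positivity)]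
    refine le_trans (le_of_eq ?_) (h.trans (by gcongr))
    congr 1
    ring
  exact (ENNReal.add_le_add_iff_right ENNReal.ofReal_ne_top).1 h2

/-- If `q ^ 3 ≤ 2 * Q`, moving from `x` to `y` costs at most `(b + 2) / Q ≤ (2 * b + 4) / q ^ 3`,
which leaves `1 / q ^ 3`; hence the constant `2 * b + 5`. If `q ^ 3 > 2 * Q`, two distinct fractions
differ by at least `1 / (q * Q)`, and `y` is within half of that from `P / Q`. -/
theorem inv_pow_four_le_abs_sub {b Q q : ℕ} {P p : ℤ} {x y e : ℝ} (hq : 0 < q) (hQ : 0 < Q)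
    (hPy : P / Q ≤ y) (hyP : y ≤ P / Q + e) (he : 2 * q * Q * e ≤ 1)
    (hne : (p / q : ℝ) ≠ P / Q) (hxy : |y - x| ≤ (b + 2) / Q)
    (hx : q ^ 3 ≤ 2 * Q → (2 * b + 5 : ℝ) / q ^ 3 ≤ |x - p / q|) :
    1 / (q : ℝ) ^ 4 ≤ |y - p / q| := by
  have hq1 : (1 : ℝ) ≤ q := by exact_mod_cast hq
  have hQ0 : (0 : ℝ) < Q := by exact_mod_cast hQ
  have hq0 : (0 : ℝ) < q := by linarith
  rcases le_or_gt (q ^ 3) (2 * Q) with h | h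
  · have h1 := hx h
    have h' : (q : ℝ) ^ 3 ≤ 2 * Q := by exact_mod_cast h
    have h2 : ((b : ℝ) + 2) / Q ≤ (2 * b + 4) / q ^ 3 := by
      rw [div_le_div_iff₀ hQ0 (by positivity)]
      nlinarith [(Nat.cast_nonneg b : (0 : ℝ) ≤ b)]
    have h3 : |x - p / q| ≤ |y - x| + |y - p / q| := by
      rw [abs_sub_comm y x]
      exact abs_sub_le _ _ _
    have h4 : (2 * b + 5 : ℝ) / q ^ 3 = (2 * b + 4) / q ^ 3 + 1 / q ^ 3 := by ring
    have h5 : 1 / (q : ℝ) ^ 4 ≤ 1 / q ^ 3 := by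
      refine one_div_le_one_div_of_le (by positivity) (pow_le_pow_right₀ hq1 (by norm_num))
    linarith
  · have h' : 2 * Q < (q : ℝ) ^ 3 := by exact_mod_cast h
    have h1 : 1 / (q * Q : ℝ) ≤ |(P / Q - p / q : ℝ)| := by
      have e1 : (P / Q - p / q : ℝ) = ((P * q - p * Q : ℤ) : ℝ) / (q * Q) := by
        push_cast
        field_simp
      rw [e1, abs_div, abs_of_pos (mul_pos hq0 hQ0)]
      gcongr
      rw [← Int.cast_abs]
      have : P * q - p * Q ≠ 0 := by
        intro h0
        apply hne
        rw [div_eq_div_iff hq0.ne' hQ0.ne']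
        exact_mod_cast (sub_eq_zero.1 h0).symm
      exact_mod_cast Int.one_le_abs this
    have h2 : |(P / Q - p / q : ℝ)| ≤ |y - P / Q| + |y - p / q| := by
      rw [abs_sub_comm y]
      exact abs_sub_le _ _ _
    have h3 : |y - P / Q| ≤ e := by
      rw [abs_of_nonneg (by linarith)]
      linarith
    have h4 : e ≤ 1 / (2 * (q * Q)) := by
      rw [le_div_iff₀ (by positivity)]
      linarith
    have h5 : 1 / (q * Q : ℝ) = 1 / (2 * (q * Q)) + 1 / (2 * (q * Q)) := by
      field_simp
      norm_num
    have h6 : 1 / (q : ℝ) ^ 4 ≤ 1 / (2 * (q * Q)) := by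
      gcongr
      nlinarith
    linarith

/-! ### Windows -/

/-- The points whose distance to `P / b ^ n`, on its right, is of order `(b ^ n) ^ (-l)`. -/
def window (b : ℕ) (l : ℝ) (n : ℕ) (P : ℤ) : Set ℝ :=
  Icc (P / (b : ℝ) ^ n + ((b : ℝ) ^ n) ^ (-l)) (P / (b : ℝ) ^ n + 2 * ((b : ℝ) ^ n) ^ (-l))

theorem exists_modEq_one_div_mem {b : ℕ} (hb : 0 < b) {Q : ℝ} (hQ : 0 < Q) (x : ℝ) :
    ∃ P : ℤ, P ≡ 1 [ZMOD b] ∧ x ≤ P / Q ∧ P / Q ≤ x + b / Q := by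
  have hb' : (0 : ℝ) < b := by exact_mod_cast hb
  refine ⟨b * ⌈(x * Q - 1) / b⌉ + 1, ?_, ?_, ?_⟩
  · simp [Int.ModEq]
  · have := Int.le_ceil ((x * Q - 1) / b)
    rw [div_le_iff₀ hb'] at this
    rw [le_div_iff₀ hQ]
    push_cast
    linarith
  · have := (Int.ceil_lt_add_one ((x * Q - 1) / b)).le
    have h2 := mul_le_mul_of_nonneg_left this hb'.le
    have e : (b : ℝ) * ((x * Q - 1) / b + 1) = x * Q - 1 + b := by field_simp
    rw [e] at h2
    rw [div_le_iff₀ hQ, add_mul, div_mul_cancel₀ _ hQ.ne']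
    push_cast
    linarith

theorem two_mul_rpow_neg_le {Q l : ℝ} (hQ : 2 ≤ Q) (hl : 4 ≤ l) : 2 * Q ^ (-l) ≤ 1 / Q := by
  have hQ0 : 0 < Q := by linarith
  have h : Q ^ (-l) ≤ Q ^ (-2 : ℝ) := Real.rpow_le_rpow_of_exponent_le (by linarith) (by linarith)
  have e : Q ^ (-2 : ℝ) = 1 / Q ^ 2 := by
    rw [Real.rpow_neg hQ0.le]
    norm_num
  rw [e] at h
  calc 2 * Q ^ (-l) ≤ 2 * (1 / Q ^ 2) := by gcongr
    _ ≤ 1 / Q := by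
      rw [mul_one_div, div_le_div_iff₀ (by positivity) hQ0]
      nlinarith

theorem lt_abs_sub_of_mem_window {b n : ℕ} {l y y' : ℝ} {P P' : ℤ} (hb : 2 ≤ b) (hn : n ≠ 0)
    (hl : 4 ≤ l) (hP : P ≡ 1 [ZMOD b]) (hP' : P' ≡ 1 [ZMOD b]) (hne : P ≠ P')
    (hy : y ∈ window b l n P) (hy' : y' ∈ window b l n P') :
    1 / (2 * (b : ℝ) ^ n) < |y - y'| := by
  have hb' : (2 : ℝ) ≤ b := by exact_mod_cast hb
  have hQ : 2 ≤ (b : ℝ) ^ n := hb'.trans (le_self_pow₀ (by linarith) hn)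
  set Q := (b : ℝ) ^ n with hQdef
  have hQ0 : 0 < Q := by linarith
  have he := two_mul_rpow_neg_le hQ hl
  have he0 : 0 < Q ^ (-l) := Real.rpow_pos_of_pos hQ0 _
  have hdvd : (b : ℤ) ∣ P - P' := (hP'.trans hP.symm).dvd
  have h1 : (b : ℤ) ≤ |P - P'| :=
    Int.le_of_dvd (abs_pos.2 (sub_ne_zero.2 hne)) ((dvd_abs _ _).2 hdvd)
  have h1' : (2 : ℝ) ≤ |(P : ℝ) - P'| := by
    have : ((b : ℤ) : ℝ) ≤ ((|P - P'| : ℤ) : ℝ) := by exact_mod_cast h1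
    push_cast at this
    linarith
  have h2 : 2 / Q ≤ |P / Q - P' / Q| := by
    rw [← sub_div, abs_div, abs_of_pos hQ0]
    gcongr
  simp only [window, ← hQdef, mem_Icc] at hy hy'
  have h3 : |(P / Q - P' / Q) - (y - y')| ≤ Q ^ (-l) := by
    rw [abs_le]
    constructor <;> linarith [hy.1, hy.2, hy'.1, hy'.2]
  have h4 := abs_sub_abs_le_abs_sub (P / Q - P' / Q) (y - y')
  have h5 : 2 / Q = 2 * (1 / Q) := by ring
  have h6 : 1 / (2 * Q) = (1 / Q) / 2 := by field_simp
  have h7 : 0 < 1 / Q := by positivity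
  linarith

/-- These are the conditions `hM` and `hML` of the measure estimate for a window of length `L = Q ^
(-l)` and denominators from `M ≈ Q ^ (l - 1) / 4` on: `L * M ^ 2` is then at least `Q ^ (l - 2) /
16`. -/
theorem far_from_rationals_bounds {Q l C : ℝ} (hl : 4 ≤ l) (hC : 1 ≤ C) (hQ : 2048 * C ≤ Q) :
    16 * C ≤ ⌈Q ^ (l - 1) / 4⌉₊ ∧ 96 * C ≤ Q ^ (-l) * (⌈Q ^ (l - 1) / 4⌉₊ : ℝ) ^ 2 := by
  have hQ1 : 1 ≤ Q := by linarith
  have hQ0 : 0 < Q := by linarith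
  have hM := Nat.le_ceil (Q ^ (l - 1) / 4)
  have h1 : Q ≤ Q ^ (l - 1) := by
    conv_lhs => rw [← Real.rpow_one Q]
    exact Real.rpow_le_rpow_of_exponent_le hQ1 (by linarith)
  have h2 : Q ≤ Q ^ (l - 2) := by
    conv_lhs => rw [← Real.rpow_one Q]
    exact Real.rpow_le_rpow_of_exponent_le hQ1 (by linarith)
  refine ⟨by linarith, ?_⟩
  calc 96 * C ≤ Q ^ (l - 2) / 16 := by linarith
    _ = Q ^ (-l) * (Q ^ (l - 1) / 4) ^ 2 := by
      rw [div_pow, ← Real.rpow_natCast (Q ^ (l - 1)) 2, ← Real.rpow_mul hQ0.le, mul_div_assoc',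
        ← Real.rpow_add hQ0]
      norm_num
      ring_nf
    _ ≤ _ := by gcongr

theorem eventually_lt_packing_sum {b : ℕ} (hb : 2 ≤ b) {s : ℝ≥0} (hs : s < 1) {L : ℝ} (hL : 0 < L)
    {A : ℝ≥0∞} (hA : A ≠ ⊤) :
    ∀ᶠ n : ℕ in atTop, A < ENNReal.ofReal
      ((1 / (2 * (b : ℝ) ^ n)) ^ (s : ℝ) * ((b : ℝ) ^ n / b)) * ENNReal.ofReal (L / 4) := by
  have hb' : (1 : ℝ) < b := by exact_mod_cast hb
  have hs' : 0 < 1 - (s : ℝ) := sub_pos.2 (by exact_mod_cast hs)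
  have hc : 0 < 2 ^ (-(s : ℝ)) / b * (L / 4) := by positivity
  have lim : Tendsto (fun n : ℕ => 2 ^ (-(s : ℝ)) / b * (L / 4) * ((b : ℝ) ^ n) ^ (1 - (s : ℝ)))
      atTop atTop :=
    ((tendsto_rpow_atTop hs').comp (tendsto_pow_atTop_atTop_of_one_lt hb')).const_mul_atTop hc
  filter_upwards [lim.eventually_gt_atTop A.toReal] with n hn
  have hQ : 0 < (b : ℝ) ^ n := by positivity
  rw [← ENNReal.ofReal_mul (by positivity), ENNReal.lt_ofReal_iff_toReal_lt hA]
  refine hn.trans_eq ?_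
  rw [one_div, Real.inv_rpow (by positivity), Real.mul_rpow (by norm_num) hQ.le, mul_inv,
    ← Real.rpow_neg (by norm_num), ← Real.rpow_neg hQ.le, sub_eq_add_neg, Real.rpow_add hQ,
    Real.rpow_one]
  ring

/-- Inside every window there is a smaller one that misses a given set of finite premeasure and
stays away from the rationals with denominators between the two windows. -/
theorem exists_window_subset_disjoint {b : ℕ} (hb : 2 ≤ b) {s : ℝ≥0} (hs : s < 1) {t : Set ℝ}
    (ht : packingPremeasure s t ≠ ⊤) {l l' : ℝ} (hl : 4 ≤ l) (hl' : 4 ≤ l') {n : ℕ}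
    (hn : 2048 * (2 * b + 5 : ℝ) ≤ (b : ℝ) ^ n) (P : ℤ) :
    ∃ (n' : ℕ) (P' : ℤ), n < n' ∧ P' ≡ 1 [ZMOD b] ∧ window b l' n' P' ⊆ window b l n P ∧
      Disjoint (window b l' n' P') t ∧
      ∀ y ∈ window b l' n' P', ∀ q : ℕ, ((b : ℝ) ^ n) ^ (l - 1) ≤ 4 * q →
        4 * q < ((b : ℝ) ^ n') ^ (l' - 1) → ∀ p : ℤ, (p / q : ℝ) ≠ P' / (b : ℝ) ^ n' →
        1 / (q : ℝ) ^ 4 ≤ |y - p / q| := by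
  have hb0 : 0 < b := by omega
  have hb' : (2 : ℝ) ≤ b := by exact_mod_cast hb
  have hbn : 0 < (b : ℝ) ^ n := by positivity
  set L := ((b : ℝ) ^ n) ^ (-l) with hLdef
  have hL : 0 < L := Real.rpow_pos_of_pos hbn _
  obtain ⟨δ, hδ, hδt⟩ : ∃ δ : ℝ, 0 < δ ∧ packingSup s δ t ≠ ⊤ := by
    by_contra! h
    exact ht (iInf₂_eq_top.2 h)
  have hinv : Tendsto (fun m : ℕ => ((b : ℝ) ^ m)⁻¹) atTop (𝓝 0) :=
    tendsto_inv_atTop_zero.comp (tendsto_pow_atTop_atTop_of_one_lt (by linarith))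
  obtain ⟨n', hnn, hbL, hbδ, hbig⟩ := ((eventually_gt_atTop n).and
    ((hinv.eventually_lt_const (div_pos (half_pos hL) (by linarith : (0 : ℝ) < b + 2))).and
    ((hinv.eventually_lt_const hδ).and (eventually_lt_packing_sum hb hs hL hδt)))).exists
  have hQ2 : 2 ≤ (b : ℝ) ^ n' := hb'.trans (le_self_pow₀ (by linarith) (by omega))
  set Q := (b : ℝ) ^ n' with hQdef
  have hQ : 0 < Q := by linarith
  have hQnat : ((b ^ n' : ℕ) : ℝ) = Q := by push_cast; rfl
  have hbL' : (b + 2) / Q ≤ L / 2 := by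
    rw [lt_div_iff₀ (by linarith)] at hbL
    rw [div_eq_inv_mul]
    exact hbL.le
  have he := two_mul_rpow_neg_le hQ2 hl'
  have he0 : 0 < Q ^ (-l') := Real.rpow_pos_of_pos hQ _
  set u := P / (b : ℝ) ^ n + L with hu
  have hwin : window b l n P = Icc u (u + L) := by
    rw [window, hu, ← hLdef]
    congr 1
    ring
  have hwin' (P' : ℤ) : window b l' n' P' = Icc (P' / Q + Q ^ (-l')) (P' / Q + 2 * Q ^ (-l')) := rfl
  obtain ⟨hM1, hM2⟩ := far_from_rationals_bounds (C := 2 * b + 5) hl (by linarith) hn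
  -- The range `q ≤ 2 * b ^ n'` contains every `q` with `q ^ 3 ≤ 2 * b ^ n'`; larger `q` are handled
  -- by the gap between fractions.
  have hvol := ofReal_le_volume_far_from_rationals (u := u) (2 * b ^ n' + 1) hL (by linarith)
    hM1 hM2
  set G := {x ∈ Icc u (u + L / 2) | ∀ q : ℕ, ⌈((b : ℝ) ^ n) ^ (l - 1) / 4⌉₊ ≤ q →
    q < 2 * b ^ n' + 1 → ∀ p : ℤ, (2 * b + 5 : ℝ) / q ^ 3 ≤ |x - p / q|}
  -- Numerators of the admissible windows: those whose fraction lies at most `b / Q` to the right of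
  -- a good point.
  set S := {P' : ℤ | P' ≡ 1 [ZMOD b] ∧ ∃ x ∈ G, x ≤ P' / Q ∧ P' / Q ≤ x + b / Q}
  suffices h : ∃ P' ∈ S, Disjoint (window b l' n' P') t by
    obtain ⟨P', ⟨hmod, x, hxG, hxP, hPx⟩, hdis⟩ := h
    have e : ((b : ℝ) + 2) / Q = b / Q + 2 * (1 / Q) := by ring
    have hinvQ : 0 < 1 / Q := by positivity
    refine ⟨n', P', hnn, hmod, ?_, hdis, ?_⟩
    · rw [hwin, hwin']
      refine Icc_subset_Icc ?_ ?_
      · linarith [hxG.1.1]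
      · linarith [hxG.1.2]
    · intro y hy q hq1 hq2 p hne
      rw [hwin'] at hy
      have hq0 : 0 < q := by
        have : 0 < ((b : ℝ) ^ n) ^ (l - 1) := Real.rpow_pos_of_pos hbn _
        have : (0 : ℝ) < q := by linarith
        exact_mod_cast this
      refine inv_pow_four_le_abs_sub (b := b) (Q := b ^ n') (P := P') (x := x)
        (e := 2 * Q ^ (-l')) hq0 (by positivity) ?_ ?_ ?_ ?_ ?_ ?_
      · rw [hQnat]; linarith [hy.1]
      · rw [hQnat]; exact hy.2
      · rw [hQnat]
        -- The range `4 * q < Q ^ (l' - 1)` is exactly what keeps the window's extent `2 * Q ^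
        -- (-l')` below half of `1 / (q * Q)`.
        have e1 : Q * Q ^ (-l') * Q ^ (l' - 1) = 1 := by
          rw [mul_assoc, ← Real.rpow_add hQ, show -l' + (l' - 1) = -1 by ring, Real.rpow_neg_one,
            mul_inv_cancel₀ hQ.ne']
        have h1 : 0 < Q * Q ^ (-l') := mul_pos hQ he0
        nlinarith [mul_lt_mul_of_pos_left hq2 h1]
      · rwa [hQnat]
      · rw [hQnat, abs_of_nonneg (by linarith [hy.1])]
        linarith [hy.2]
      · intro hq3
        refine hxG.2 q ?_ ?_ p
        · rw [Nat.ceil_le]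
          linarith
        · have := Nat.le_self_pow (show 3 ≠ 0 by norm_num) q
          omega
  by_contra! hmeet
  simp only [not_disjoint_iff] at hmeet
  choose! y hyw hyt using hmeet
  have hpack : ∑' _ : S, ENNReal.ofReal (2 * (1 / (4 * Q))) ^ (s : ℝ) ≤ packingSup s δ t := by
    refine tsum_le_packingSup_of_separated y (by positivity) ?_ hyt ?_
    · refine le_trans ?_ hbδ.le
      rw [one_div]
      exact inv_anti₀ hQ (by linarith)
    · intro i hi j hj hij
      refine lt_of_le_of_lt (le_of_eq ?_)
        (lt_abs_sub_of_mem_window hb (by omega) hl' hi.1 hj.1 hij (hyw i hi) (hyw j hj))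
      rw [← hQdef]
      field_simp
      norm_num
  -- Intervals of length `b / Q` ending at the fractions of `S` cover `G`, so measure bounds the
  -- size of `S` from below.
  have hcov : volume G ≤ ∑' _ : S, ENNReal.ofReal (b / Q) := by
    have hsub : G ⊆ ⋃ P' : S, Icc ((P' : ℤ) / Q - b / Q : ℝ) ((P' : ℤ) / Q) := by
      intro x hx
      obtain ⟨P', hm, h1, h2⟩ := exists_modEq_one_div_mem hb0 hQ x
      exact mem_iUnion.2 ⟨⟨P', hm, x, hx, h1, h2⟩, by simp only; linarith, h1⟩
    refine (measure_mono hsub).trans ((measure_iUnion_le _).trans (le_of_eq ?_))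
    simp only [Real.volume_Icc, sub_sub_cancel]
  have heq : ∑' _ : S, ENNReal.ofReal (2 * (1 / (4 * Q))) ^ (s : ℝ) =
      ENNReal.ofReal ((1 / (2 * Q)) ^ (s : ℝ) * (Q / b)) * ∑' _ : S, ENNReal.ofReal (b / Q) := by
    rw [← ENNReal.tsum_mul_left]
    refine tsum_congr fun _ => ?_
    rw [ENNReal.ofReal_rpow_of_pos (by positivity), ← ENNReal.ofReal_mul (by positivity)]
    congr 1
    rw [mul_assoc, div_mul_div_cancel₀ (by positivity), div_self hQ.ne', mul_one]
    congr 1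
    field_simp
    norm_num
  refine absurd hbig (not_lt.2 ?_)
  refine le_trans ?_ hpack
  rw [heq]
  gcongr
  exact hvol.trans hcov

/-! ### The exponents of a point in a nested sequence of windows -/

theorem approxExponent_mono {D E : Set ℕ} (h : D ⊆ E) (ξ : ℝ) :
    approxExponent D ξ ≤ approxExponent E ξ :=
  iSup_mono fun _ => iSup_mono' fun hm =>
    ⟨hm.mono (by rintro _ ⟨p, q, hq, hr⟩; exact ⟨p, q, h hq, hr⟩), le_rfl⟩

theorem baryExponent_le_irrExponent {b : ℕ} (hb : 0 < b) (ξ : ℝ) :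
    baryExponent b ξ ≤ irrExponent ξ :=
  approxExponent_mono (by rintro _ ⟨N, rfl⟩; exact pow_pos hb N) ξ

/-- The congruence puts `P / b ^ n` in lowest terms, so different levels give different rationals
and any other representation has denominator divisible by `b ^ n`. -/
theorem den_div_pow_of_modEq_one {b : ℕ} (hb : 0 < b) {P : ℤ} (hP : P ≡ 1 [ZMOD b]) (n : ℕ) :
    ((P : ℚ) / ((b ^ n : ℕ) : ℚ)).den = b ^ n := by
  have h1 : IsCoprime P b := by
    obtain ⟨k, hk⟩ := hP.dvd
    exact ⟨1, k, by linarith⟩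
  have h2 : IsCoprime P ((b ^ n : ℕ) : ℤ) := by
    push_cast
    exact h1.pow_right
  have h3 := Rat.den_div_eq_of_coprime (a := P) (b := ((b ^ n : ℕ) : ℤ)) (by positivity)
    (Int.isCoprime_iff_gcd_eq_one.1 h2)
  exact_mod_cast h3

theorem coe_le_baryExponent_of_mem_window {b : ℕ} (hb : 2 ≤ b) {ξ m : ℝ} {l : ℕ → ℝ} {n : ℕ → ℕ}
    {P : ℕ → ℤ} (hn : StrictMono n) (hP : ∀ k, P k ≡ 1 [ZMOD b])
    (hξ : ∀ k, ξ ∈ window b (l k) (n k) (P k)) {ε : ℝ} (hε : 0 < ε)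
    (hl : ∀ᶠ k in atTop, m + ε ≤ l k) : (m : EReal) ≤ baryExponent b ξ := by
  have hb' : (1 : ℝ) < b := by exact_mod_cast hb
  have hinj : Function.Injective fun k => (P k : ℚ) / ((b ^ n k : ℕ) : ℚ) := by
    intro i j hij
    have h := congrArg Rat.den hij
    simp only [den_div_pow_of_modEq_one (by omega : 0 < b) (hP _)] at h
    exact hn.injective (Nat.pow_right_injective hb h)
  have hlarge : ∀ᶠ k in atTop, 2 ≤ ((b : ℝ) ^ n k) ^ ε :=
    ((tendsto_rpow_atTop hε).comp ((tendsto_pow_atTop_atTop_of_one_lt hb').comp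
      hn.tendsto_atTop)).eventually_ge_atTop 2
  have hev := hl.and hlarge
  refine le_iSup₂_of_le m ?_ le_rfl
  have hinf : {k | m + ε ≤ l k ∧ 2 ≤ ((b : ℝ) ^ n k) ^ ε}.Infinite :=
    Nat.frequently_atTop_iff_infinite.1 hev.frequently
  refine (hinf.image hinj.injOn).mono ?_
  rintro _ ⟨k, ⟨h1, h2⟩, rfl⟩
  refine ⟨P k, b ^ n k, ⟨n k, rfl⟩, rfl, ?_⟩
  have hx := hξ k
  simp only [window, mem_Icc] at hx
  have hQ1 : 1 ≤ (b : ℝ) ^ n k := one_le_pow₀ hb'.le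
  push_cast
  set Q := (b : ℝ) ^ n k
  have hQ0 : 0 < Q := by linarith
  have h3 : 0 < Q ^ (-l k) := Real.rpow_pos_of_pos hQ0 _
  rw [abs_of_nonneg (by linarith)]
  -- The spare `ε` in the exponent absorbs the factor 2.
  calc ξ - P k / Q ≤ 2 * Q ^ (-l k) := by linarith
    _ ≤ Q ^ ε * Q ^ (-(m + ε)) := by
      gcongr
    _ = Q ^ (-m) := by
      rw [← Real.rpow_add hQ0]
      ring_nf

theorem finite_rat_near (ξ : ℝ) (N : ℕ) :
    {r : ℚ | ∃ (p : ℤ) (q : ℕ), 0 < q ∧ q < N ∧ r = (p : ℚ) / (q : ℚ) ∧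
      |ξ - (r : ℝ)| ≤ 1}.Finite := by
  set A := ⌈(|ξ| + 1) * N⌉
  refine (((Set.finite_Icc (-A) A).prod (Set.finite_Iio N)).image
    fun z : ℤ × ℕ => (z.1 : ℚ) / (z.2 : ℚ)).subset ?_
  rintro r ⟨p, q, hq0, hqN, rfl, hr⟩
  refine ⟨(p, q), ⟨abs_le.1 ?_, hqN⟩, rfl⟩
  have hq0' : (0 : ℝ) < q := by exact_mod_cast hq0
  have hqN' : (q : ℝ) ≤ N := by exact_mod_cast hqN.le
  push_cast at hr
  have h1 : |(p / q : ℝ)| ≤ |ξ| + 1 := by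
    have := abs_sub_abs_le_abs_sub (p / q : ℝ) ξ
    rw [abs_sub_comm] at this
    linarith
  rw [abs_div, abs_of_pos hq0', div_le_iff₀ hq0'] at h1
  have h2 : ((|p| : ℤ) : ℝ) ≤ (|ξ| + 1) * N := by
    push_cast
    exact h1.trans (by gcongr)
  exact_mod_cast h2.trans (Int.le_ceil _)

/-- Let `m > l`. The centres `P k / b ^ n k` are not solutions, because the window stays at distance
at least `(b ^ n k) ^ (-l)` from them. For any other fraction with large `q`, the ranges in `hfar`
are consecutive, so one of them contains `4 * q` and gives distance at least `q ^ (-4) > q ^ (-m)`.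
Only bounded denominators remain. -/
theorem irrExponent_le_of_mem_window {b : ℕ} (hb : 2 ≤ b) {ξ l : ℝ} (hl : 4 ≤ l) {n : ℕ → ℕ}
    {P : ℕ → ℤ} (hn : StrictMono n) (hn0 : n 0 ≠ 0) (hP : ∀ k, P k ≡ 1 [ZMOD b])
    (hξ : ∀ k, ξ ∈ window b l (n k) (P k))
    (hfar : ∀ k, ∀ q : ℕ, ((b : ℝ) ^ n k) ^ (l - 1) ≤ 4 * q →
        4 * q < ((b : ℝ) ^ n (k + 1)) ^ (l - 1) → ∀ p : ℤ,
        (p / q : ℝ) ≠ P (k + 1) / (b : ℝ) ^ n (k + 1) → 1 / (q : ℝ) ^ 4 ≤ |ξ - p / q|) :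
    irrExponent ξ ≤ l := by
  have hb' : (1 : ℝ) < b := by exact_mod_cast hb
  refine iSup₂_le fun m hm => ?_
  by_contra! hlm
  have hlm : l < m := by exact_mod_cast hlm
  have hgrow : Tendsto (fun k => ((b : ℝ) ^ n k) ^ (l - 1)) atTop atTop :=
    (tendsto_rpow_atTop (by linarith)).comp
      ((tendsto_pow_atTop_atTop_of_one_lt hb').comp hn.tendsto_atTop)
  have hne : ∀ k, ∀ (p : ℤ) (q : ℕ), 0 < q → |ξ - p / q| ≤ (q : ℝ) ^ (-m) →
      (p / q : ℝ) ≠ P k / (b : ℝ) ^ n k := by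
    intro k p q hq hle heq
    have hnk : n k ≠ 0 := by
      have := hn.monotone (Nat.zero_le k)
      omega
    have hQ1 : 1 < (b : ℝ) ^ n k := one_lt_pow₀ hb' hnk
    have hratQ : (p : ℚ) / q = (P k : ℚ) / ((b ^ n k : ℕ) : ℚ) := by
      have : (((p : ℚ) / q : ℚ) : ℝ) = (((P k : ℚ) / ((b ^ n k : ℕ) : ℚ) : ℚ) : ℝ) := by
        push_cast
        exact heq
      exact_mod_cast this
    have hdvd : b ^ n k ∣ q := by
      rw [← den_div_pow_of_modEq_one (by omega : 0 < b) (hP k) (n k), ← hratQ]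
      have := Rat.den_dvd p q
      rw [Rat.divInt_eq_div] at this
      exact_mod_cast this
    have hQq : (b : ℝ) ^ n k ≤ q := by exact_mod_cast Nat.le_of_dvd hq hdvd
    rw [heq] at hle
    have hx := hξ k
    simp only [window, mem_Icc] at hx
    have h1 : (q : ℝ) ^ (-m) ≤ ((b : ℝ) ^ n k) ^ (-m) :=
      Real.rpow_le_rpow_of_nonpos (by linarith) hQq (by linarith)
    have h2 : ((b : ℝ) ^ n k) ^ (-m) < ((b : ℝ) ^ n k) ^ (-l) :=
      Real.rpow_lt_rpow_of_exponent_lt hQ1 (by linarith)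
    have h3 := le_abs_self (ξ - P k / (b : ℝ) ^ n k)
    linarith [hx.1]
  obtain ⟨N, hN⟩ := exists_nat_gt (((b : ℝ) ^ n 0) ^ (l - 1) + 1)
  refine hm ((finite_rat_near ξ N).subset ?_)
  rintro r ⟨p, q, hq, rfl, hr⟩
  have hq0 : 0 < q := hq
  have hq1 : (1 : ℝ) ≤ q := by exact_mod_cast hq0
  refine ⟨p, q, hq0, ?_, rfl, hr.trans (Real.rpow_le_one_of_one_le_of_nonpos hq1 (by linarith))⟩
  by_contra! hNq
  have hNq' : (N : ℝ) ≤ q := by exact_mod_cast hNq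
  push_cast at hr
  have h0 : ((b : ℝ) ^ n 0) ^ (l - 1) ≤ 4 * q := by linarith
  have hq1' : 1 < (q : ℝ) := by
    have : 0 < ((b : ℝ) ^ n 0) ^ (l - 1) := by positivity
    linarith
  obtain ⟨k, hk1, hk2⟩ : ∃ k, ((b : ℝ) ^ n k) ^ (l - 1) ≤ 4 * q ∧
      4 * q < ((b : ℝ) ^ n (k + 1)) ^ (l - 1) := by
    by_contra! h
    have hall : ∀ k, ((b : ℝ) ^ n k) ^ (l - 1) ≤ 4 * q := fun k => by
      induction k with
      | zero => exact h0
      | succ k ih => exact h k ih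
    obtain ⟨k, hk⟩ := (hgrow.eventually_gt_atTop (4 * (q : ℝ))).exists
    exact (hall k).not_gt hk
  have h1 := hfar k q hk1 hk2 p (hne (k + 1) p q hq0 hr)
  have h2 : (q : ℝ) ^ (-m) < (q : ℝ) ^ (-4 : ℝ) :=
    Real.rpow_lt_rpow_of_exponent_lt hq1' (by linarith)
  have h3 : (q : ℝ) ^ (-4 : ℝ) = 1 / (q : ℝ) ^ 4 := by
    rw [Real.rpow_neg (by linarith)]
    norm_num
  linarith

/-- Nested windows with prescribed exponents, escaping countably many sets of finite premeasure. -/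
theorem exists_nested_windows {b : ℕ} (hb : 2 ≤ b) {s : ℝ≥0} (hs : s < 1) {t : ℕ → Set ℝ}
    (ht : ∀ k, packingPremeasure s (t k) ≠ ⊤) {l : ℕ → ℝ} (hl : ∀ k, 4 ≤ l k) :
    ∃ (ξ : ℝ) (n : ℕ → ℕ) (P : ℕ → ℤ), StrictMono n ∧ n 0 ≠ 0 ∧ (∀ k, P k ≡ 1 [ZMOD b]) ∧
      (∀ k, ξ ∈ window b (l k) (n k) (P k)) ∧ (∀ k, ξ ∉ t k) ∧
      ∀ k, ∀ q : ℕ, ((b : ℝ) ^ n k) ^ (l k - 1) ≤ 4 * q →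
        4 * q < ((b : ℝ) ^ n (k + 1)) ^ (l (k + 1) - 1) → ∀ p : ℤ,
        (p / q : ℝ) ≠ P (k + 1) / (b : ℝ) ^ n (k + 1) → 1 / (q : ℝ) ^ 4 ≤ |ξ - p / q| := by
  have hb' : (1 : ℝ) < b := by exact_mod_cast hb
  obtain ⟨n₀, hn₀⟩ := pow_unbounded_of_one_lt (2048 * (2 * b + 5 : ℝ)) hb'
  have step : ∀ (k : ℕ) (z : {z : ℕ × ℤ // 2048 * (2 * b + 5 : ℝ) ≤ (b : ℝ) ^ z.1 ∧
      z.2 ≡ 1 [ZMOD b]}), ∃ z' : {z : ℕ × ℤ // 2048 * (2 * b + 5 : ℝ) ≤ (b : ℝ) ^ z.1 ∧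
      z.2 ≡ 1 [ZMOD b]}, z.1.1 < z'.1.1 ∧
      window b (l (k + 1)) z'.1.1 z'.1.2 ⊆ window b (l k) z.1.1 z.1.2 ∧
      Disjoint (window b (l (k + 1)) z'.1.1 z'.1.2) (t k) ∧
      ∀ y ∈ window b (l (k + 1)) z'.1.1 z'.1.2, ∀ q : ℕ,
        ((b : ℝ) ^ z.1.1) ^ (l k - 1) ≤ 4 * q →
        4 * q < ((b : ℝ) ^ z'.1.1) ^ (l (k + 1) - 1) → ∀ p : ℤ,
        (p / q : ℝ) ≠ z'.1.2 / (b : ℝ) ^ z'.1.1 → 1 / (q : ℝ) ^ 4 ≤ |y - p / q| := by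
    intro k z
    obtain ⟨n', P', h1, h2, h3⟩ :=
      exists_window_subset_disjoint hb hs (ht k) (hl k) (hl (k + 1)) z.2.1 z.1.2
    exact ⟨⟨(n', P'), z.2.1.trans (pow_le_pow_right₀ hb'.le h1.le), h2⟩, h1, h3⟩
  choose f hf using step
  let z := fun k => Nat.rec (motive := fun _ => {z : ℕ × ℤ //
      2048 * (2 * b + 5 : ℝ) ≤ (b : ℝ) ^ z.1 ∧ z.2 ≡ 1 [ZMOD b]})
    ⟨(n₀, 1), hn₀.le, rfl⟩ (fun k z => f k z) k
  obtain ⟨ξ, hξ⟩ := IsCompact.nonempty_iInter_of_sequence_nonempty_isCompact_isClosed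
    (fun k => window b (l k) (z k).1.1 (z k).1.2) (fun k => (hf k (z k)).2.1)
    (fun k => nonempty_Icc.2 (by
      have : 0 < ((b : ℝ) ^ (z k).1.1) ^ (-l k) := by positivity
      linarith)) isCompact_Icc (fun _ => isClosed_Icc)
  rw [mem_iInter] at hξ
  refine ⟨ξ, fun k => (z k).1.1, fun k => (z k).1.2, strictMono_nat_of_lt_succ fun k =>
    (hf k (z k)).1, ?_, fun k => (z k).2.2, hξ, fun k =>
    disjoint_left.1 (hf k (z k)).2.2.1 (hξ (k + 1)), fun k => (hf k (z k)).2.2.2 ξ (hξ (k + 1))⟩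
  intro h
  have := (z 0).2.1
  rw [show (z 0).1.1 = 0 from h, pow_zero] at this
  linarith

theorem exists_mem_levelW_inter_levelV_notMem {b : ℕ} (hb : 2 ≤ b) {lam : EReal}
    (hlam : (4 : ℝ) < lam) {s : ℝ≥0} (hs : s < 1) {t : ℕ → Set ℝ}
    (ht : ∀ k, packingPremeasure s (t k) ≠ ⊤) :
    ∃ ξ ∈ levelW lam ∩ levelV b lam, ∀ k, ξ ∉ t k := by
  suffices h : ∃ ξ, lam ≤ baryExponent b ξ ∧ irrExponent ξ ≤ lam ∧ ∀ k, ξ ∉ t k by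
    obtain ⟨ξ, h1, h2, h3⟩ := h
    have h4 := baryExponent_le_irrExponent (by omega : 0 < b) ξ
    exact ⟨ξ, ⟨le_antisymm h2 (h1.trans h4), le_antisymm (h4.trans h2) h1⟩, h3⟩
  induction lam with
  | bot => simp at hlam
  | top =>
    -- For an infinite exponent the window exponents must tend to infinity, while starting at 4.
    obtain ⟨ξ, n, P, hn, -, hP, hξ, hξt, -⟩ := exists_nested_windows hb hs ht
      (l := fun k => k + 4) fun k => by simp
    refine ⟨ξ, ?_, le_top, hξt⟩
    refine EReal.ge_of_forall_gt_iff_ge.1 fun m _ =>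
      coe_le_baryExponent_of_mem_window hb hn hP hξ one_pos ?_
    filter_upwards [tendsto_natCast_atTop_atTop.eventually_ge_atTop m] with k hk
    linarith
  | coe l =>
    have hl : 4 < l := by exact_mod_cast hlam
    obtain ⟨ξ, n, P, hn, hn0, hP, hξ, hξt, hfar⟩ := exists_nested_windows hb hs ht
      (l := fun _ => l) fun _ => hl.le
    refine ⟨ξ, ?_, irrExponent_le_of_mem_window hb hl.le hn hn0 hP hξ hfar, hξt⟩
    refine EReal.ge_of_forall_gt_iff_ge.1 fun m hm => ?_
    have hm : m < l := by exact_mod_cast hm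
    exact coe_le_baryExponent_of_mem_window hb hn hP hξ (sub_pos.2 hm)
      (Eventually.of_forall fun _ => by linarith)

end DiophPacking

theorem corollaryc3 (b : ℕ) (hb : 2 ≤ b) (lam : EReal)
    (hlam : (((5 + Real.sqrt 17) / 2 : ℝ) : EReal) < lam) :
    DiophPacking.dimP (DiophPacking.levelW lam ∩ DiophPacking.levelV b lam) = 1 := by
  have h17 : (4 : ℝ) ≤ (5 + Real.sqrt 17) / 2 := by
    have : (3 : ℝ) ≤ Real.sqrt 17 := Real.le_sqrt_of_sq_le (by norm_num)
    linarith
  have h4 : ((4 : ℝ) : EReal) < lam := lt_of_le_of_lt (by exact_mod_cast h17) hlam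
  exact le_antisymm (DiophPacking.dimP_le_one _) (DiophPacking.one_le_dimP fun _ hs =>
    DiophPacking.packingMeasure_eq_top_of_forall fun _ ht =>
      DiophPacking.exists_mem_levelW_inter_levelV_notMem hb h4 hs ht)
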